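/- Fix $q\in[0,1)$ and positive constants $K,R,\kappa,\tau$. For each $n$ let $p=p_n\ge 2$ be an integer and $s_p,M_p$ real numbers, such that, as $n\to\infty$, $\log p=o(n)$ and $s_pM_p^{1-2q}=o\big((n/\log p)^{\frac12-\frac q2}\big)$. Let $X_1,\dots,X_n\in\mathbb R^p$ be i.i.d. with mean $\mu$ and covariance matrix $\Sigma$, where $|\mu_i|\le R$ and $E(X_{1i}-\mu_i)^4\le K$ (with finite fourth moments) for all $1\le i\le p$. Suppose that $\Omega=\Sigma^{-1}$ belongs to $\mathcal U_q(s_p,M_p)$, that is, $\Omega\succ0$, $\max_j\sum_i|\omega_{ij}|^q\le s_p$ (with $|0|^0=0$) and $\|\Omega\|_{L_1}\le M_p$. Here $\|A\|_\infty=\max_{i,j}|a_{ij}|$ and $\|A\|_{L_1}=\max_j\sum_i|a_{ij}|$. *Robust covariance estimator.* Let $\psi_H(x)=\min\{H,\max(-H,x)\}$ and $H=\kappa(n/\log p)^{1/2}$. Let $\tilde\mu_i$ and $\tilde\sigma_{ij}$ solve $\sum_{k=1}^n\psi_H(X_{ki}-\tilde\mu_i)=0$ and $\sum_{k=1}^n\psi_H\big(X_{ki}X_{kj}-(\tilde\sigma_{ij}+\tilde\mu_i\tilde\mu_j)\big)=0$,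 put $\tilde\Sigma=(\tilde\sigma_{ij})$, and let $\hat\Sigma\in\operatorname{argmin}_{T\succeq\varepsilon I}\|T-\tilde\Sigma\|_\infty$, where $\varepsilon=\varepsilon_n>0$ is so small that $\Sigma\succeq\varepsilon I$. *SCIO.* Let $\lambda=C_0M_p\sqrt{\log p/n}$, and for each $i$ let $\hat\beta_i\in\operatorname{argmin}_{\beta\in\mathbb R^p}\{\frac12\beta^{\top}\hat\Sigma\beta-e_i^{\top}\beta+\lambda|\beta|_1\}$, where $e_i$ is the $i$-th column of the identity. Let $\hat\Omega=(\hat\beta_1,\dots,\hat\beta_p)$ and let $\tilde\Omega$ be the symmetric matrix whose entry $\tilde\omega_{ij}=\tilde\omega_{ji}$ is the one of $\hat\omega_{ij},\hat\omega_{ji}$ that has the smaller absolute value (either one in case of a tie). Then there is a threshold for $C_0$, depending only on $q,K,R,\kappa,\tau$, such that for every $C_0$ at or above it there are constants $C_1,C_2,C_3>0$, depending only on $q,K,R,\kappa,\tau,C_0$, with the following property. For all sufficiently large $n$, the threshold for $n$ being uniform over all distributions and all $\varepsilon$ as above, the estimator $\tilde\Omega$ exists for every sample and, whatever choice is made where a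 defining equation or minimization has several solutions, $$\|\tilde\Omega-\Omega\|_\infty\le C_1M_p^2\sqrt{\frac{\log p}{n}},\qquad \|\tilde\Omega-\Omega\|_{L_1}\le C_2\,s_pM_p^{2-2q}\Big(\frac{\log p}{n}\Big)^{\frac12(1-q)}$$ hold with probability at least $1-C_3p^{-\tau}$. -/

import Mathlib

open MeasureTheory ProbabilityTheory Filter Asymptotics
open scoped Matrix Topology

noncomputable section

namespace SCIO

/-- Element-wise `ℓ_∞` norm of a matrix, `max_{i,j} |a_ij|`. -/
def maxNorm {p : ℕ} (A : Matrix (Fin p) (Fin p) ℝ) : ℝ :=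
  ⨆ ij : Fin p × Fin p, |A ij.1 ij.2|

/-- Matrix `ℓ₁` norm, the largest absolute column sum. -/
def l1Norm {p : ℕ} (A : Matrix (Fin p) (Fin p) ℝ) : ℝ :=
  ⨆ j : Fin p, ∑ i : Fin p, |A i j|

/-- `∑ᵢ |ω_ij|^q` for the column `j`, with the convention `|0|^0 = 0`, so that for `q = 0` it is
the number of nonzero entries of the column. -/
def colSparsity {p : ℕ} (q : ℝ) (A : Matrix (Fin p) (Fin p) ℝ) (j : Fin p) : ℝ :=
  ∑ i : Fin p, if A i j = 0 then 0 else |A i j| ^ q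

/-- The class `U_q(s, M)` of weakly sparse positive definite matrices. -/
structure SparseClass {p : ℕ} (q s M : ℝ) (A : Matrix (Fin p) (Fin p) ℝ) : Prop where
  posDef : A.PosDef
  sparse : ∀ j, colSparsity q A j ≤ s
  l1_le : l1Norm A ≤ M

/-- Mean of the `i`-th coordinate under the population law `P`. -/
def popMean {p : ℕ} (P : Measure (Fin p → ℝ)) (i : Fin p) : ℝ := ∫ x, x i ∂P

/-- Population covariance matrix of the law `P`. -/
def popCov {p : ℕ} (P : Measure (Fin p → ℝ)) : Matrix (Fin p) (Fin p) ℝ :=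
  Matrix.of fun i j => cov[fun x => x i, fun x => x j; P]

/-- The fourth moments are finite, and the central ones are at most `K`. -/
def BoundedFourthMoments {p : ℕ} (K : ℝ) (P : Measure (Fin p → ℝ)) : Prop :=
  ∀ i, MemLp (fun x : Fin p → ℝ => x i) 4 P ∧ ∫ x, (x i - popMean P i) ^ 4 ∂P ≤ K

/-- The Huber function `ψ_H(x) = min {H, max (-H, x)}`. -/
def huberPsi (H x : ℝ) : ℝ := min H (max (-H) x)

/-- `m` is a vector of Huber mean estimates of the sample `x` (rows are observations). -/
def IsHuberMean {n p : ℕ} (H : ℝ) (x : Fin n → Fin p → ℝ) (m : Fin p → ℝ) : Prop :=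
  ∀ i, ∑ k, huberPsi H (x k i - m i) = 0

/-- `S` is a matrix of Huber covariance estimates of the sample `x`, given the mean estimates. -/
def IsHuberCov {n p : ℕ} (H : ℝ) (x : Fin n → Fin p → ℝ) (m : Fin p → ℝ)
    (S : Matrix (Fin p) (Fin p) ℝ) : Prop :=
  ∀ i j, ∑ k, huberPsi H (x k i * x k j - (S i j + m i * m j)) = 0

/-- The cone `{T : T ⪰ ε I}` of symmetric matrices. -/
def psdCone (p : ℕ) (ε : ℝ) : Set (Matrix (Fin p) (Fin p) ℝ) :=
  {T | (T - ε • (1 : Matrix (Fin p) (Fin p) ℝ)).PosSemidef}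

/-- `T` is a projection of `S` to `{T ⪰ ε I}` in the element-wise `ℓ_∞` norm. -/
def IsConeProjection {p : ℕ} (ε : ℝ) (S T : Matrix (Fin p) (Fin p) ℝ) : Prop :=
  T ∈ psdCone p ε ∧ IsMinOn (fun T' => maxNorm (T' - S)) (psdCone p ε) T

/-- `S` is a Huber-type robust covariance estimate of the sample `x`, after projection. -/
def IsRobustCov {n p : ℕ} (H ε : ℝ) (x : Fin n → Fin p → ℝ)
    (S : Matrix (Fin p) (Fin p) ℝ) : Prop :=
  ∃ (m : Fin p → ℝ) (S₀ : Matrix (Fin p) (Fin p) ℝ),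
    IsHuberMean H x m ∧ IsHuberCov H x m S₀ ∧ IsConeProjection ε S₀ S

/-- The SCIO objective `½ βᵀ S β - eᵢᵀ β + lam |β|₁` for the `i`-th column. -/
def scioObj {p : ℕ} (S : Matrix (Fin p) (Fin p) ℝ) (lam : ℝ) (i : Fin p) (β : Fin p → ℝ) : ℝ :=
  1 / 2 * (β ⬝ᵥ (S *ᵥ β)) - Pi.single i 1 ⬝ᵥ β + lam * ∑ j, |β j|

/-- The `i`-th column of `B` minimises the `i`-th SCIO objective, for every `i`. -/
def IsScioColumns {p : ℕ} (S : Matrix (Fin p) (Fin p) ℝ) (lam : ℝ)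
    (B : Matrix (Fin p) (Fin p) ℝ) : Prop :=
  ∀ i, IsMinOn (scioObj S lam i) Set.univ (fun j => B j i)

/-- `A` is the symmetrization of `B`: `a_ij = a_ji` is the one of `b_ij`, `b_ji` that has the
smaller absolute value (any of the two in case of a tie). -/
def IsSymmetrization {p : ℕ} (B A : Matrix (Fin p) (Fin p) ℝ) : Prop :=
  A.IsSymm ∧ ∀ i j, (A i j = B i j ∨ A i j = B j i) ∧ |A i j| = min |B i j| |B j i|

/-- `A` is a SCIO estimate with plug-in covariance matrix `S` and tuning parameter `lam`. -/
def IsScio {p : ℕ} (S : Matrix (Fin p) (Fin p) ℝ) (lam : ℝ)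
    (A : Matrix (Fin p) (Fin p) ℝ) : Prop :=
  ∃ B, IsScioColumns S lam B ∧ IsSymmetrization B A

/-- `A` is a SCIO estimate computed from the sample `x` through the robust covariance estimate. -/
def IsRobustScio {n p : ℕ} (H ε lam : ℝ) (x : Fin n → Fin p → ℝ)
    (A : Matrix (Fin p) (Fin p) ℝ) : Prop :=
  ∃ S, IsRobustCov H ε x S ∧ IsScio S lam A

end SCIO

end

open SCIO

/-! The argument separates a deterministic analysis of SCIO from a single probabilistic event. Write
`a = √(log p / n)`.

Probability: `ψ_H` is bounded and `exp (ψ_H(y) / H)` lies below a quadratic in `y / H`, so two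
moments suffice for a Chernoff bound. With `H = κ / a`, every root of a Huber equation lies within
`C a` of the mean outside an event of probability `2 p^{-(τ+2)}`. A union over the `p` first and
`p²` second moments costs `4 p^{-τ}` (`measure_badSet_le`). Otherwise the plug-in error is `O(a)`
entrywise; the projection at most doubles it, since `Σ` is feasible (`abs_robustCov_sub_le`).

Determinism: let `S` be entrywise `δ`-close to `Σ`, with `2δM ≤ λ`, and let `w` be a column of `Ω`.
The gradient of the smooth part at `w` is at most `λ / 2`, so comparing objective values bounds the
`ℓ₁` norm of the minimizer `b`. Stationarity then makes `Σ (b - w)` entrywise `O(λ)`, and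
multiplying by `Ω` gives an entrywise error of `3Mλ` (`scio_column_error`). No eigenvalue bound
enters. Weak sparsity turns this into an `ℓ₁` bound (`sum_abs_le_of_sparse`), once for the columns
and once for their symmetrization (`scio_error`). -/

namespace SCIO

/-! ### Matrix norms and the sparsity class -/

section Norms

variable {p : ℕ}

theorem abs_le_maxNorm (A : Matrix (Fin p) (Fin p) ℝ) (i j : Fin p) : |A i j| ≤ maxNorm A :=
  le_ciSup (f := fun ij : Fin p × Fin p => |A ij.1 ij.2|) (Set.finite_range _).bddAbove (i, j)

theorem maxNorm_le {A : Matrix (Fin p) (Fin p) ℝ} {r : ℝ} (hr : 0 ≤ r)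
    (h : ∀ i j, |A i j| ≤ r) : maxNorm A ≤ r :=
  Real.iSup_le (fun ij => h ij.1 ij.2) hr

theorem sum_abs_le_l1Norm (A : Matrix (Fin p) (Fin p) ℝ) (j : Fin p) :
    ∑ i, |A i j| ≤ l1Norm A :=
  le_ciSup (f := fun j : Fin p => ∑ i, |A i j|) (Set.finite_range _).bddAbove j

theorem l1Norm_le {A : Matrix (Fin p) (Fin p) ℝ} {r : ℝ} (hr : 0 ≤ r)
    (h : ∀ j, ∑ i, |A i j| ≤ r) : l1Norm A ≤ r :=
  Real.iSup_le h hr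

theorem abs_dotProduct_le {u v : Fin p → ℝ} {c : ℝ} (hu : ∀ i, |u i| ≤ c) :
    |u ⬝ᵥ v| ≤ c * ∑ i, |v i| := by
  rw [dotProduct, Finset.mul_sum]
  refine (Finset.abs_sum_le_sum_abs _ _).trans (Finset.sum_le_sum fun i _ => ?_)
  rw [abs_mul]
  exact mul_le_mul_of_nonneg_right (hu i) (abs_nonneg _)

/-- Lets the cone projection be treated as a nearest-point problem in a finite-dimensional normed
space. -/
theorem maxNorm_eq_norm (T : Fin p → Fin p → ℝ) : maxNorm (Matrix.of T) = ‖T‖ := by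
  refine le_antisymm (maxNorm_le (norm_nonneg _) fun i j => ?_) ?_
  · exact (norm_le_pi_norm (T i) j).trans (norm_le_pi_norm T i)
  · have h0 : 0 ≤ maxNorm (Matrix.of T) := Real.iSup_nonneg fun _ => abs_nonneg _
    exact (pi_norm_le_iff_of_nonneg h0).2 fun i =>
      (pi_norm_le_iff_of_nonneg h0).2 fun j => abs_le_maxNorm (Matrix.of T) i j

theorem maxNorm_sub_le {A B C : Matrix (Fin p) (Fin p) ℝ} {a b : ℝ} (ha : maxNorm (A - B) ≤ a)
    (hb : maxNorm (C - B) ≤ b) (i j : Fin p) : |A i j - C i j| ≤ a + b := by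
  have h1 := (abs_le_maxNorm (A - B) i j).trans ha
  have h2 := (abs_le_maxNorm (C - B) i j).trans hb
  rw [Matrix.sub_apply, abs_le] at h1 h2
  rw [abs_le]
  constructor <;> linarith [h1.1, h1.2, h2.1, h2.2]

/-- A positive definite matrix has a nonzero diagonal entry in each column, which alone contributes
to both sums. -/
theorem SparseClass.pos {q s M : ℝ} {A : Matrix (Fin p) (Fin p) ℝ} (h : SparseClass q s M A)
    (j : Fin p) : 0 < s ∧ 0 < M := by
  have hd : 0 < A j j := h.posDef.diag_pos
  constructor
  · refine lt_of_lt_of_le ?_ (h.sparse j)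
    refine Finset.sum_pos' (fun i _ => ?_) ⟨j, Finset.mem_univ _, ?_⟩
    · split_ifs
      · exact le_rfl
      · positivity
    · rw [if_neg hd.ne']
      exact Real.rpow_pos_of_pos (abs_pos.2 hd.ne') q
  · refine lt_of_lt_of_le ?_ ((sum_abs_le_l1Norm A j).trans h.l1_le)
    exact Finset.sum_pos' (fun i _ => abs_nonneg _) ⟨j, Finset.mem_univ _, abs_pos.2 hd.ne'⟩

end Norms

/-! ### From entrywise error to `ℓ₁` error -/

section Thresholding

variable {p : ℕ}

/-- An error vector that is small in `ℓ_∞` and almost does not increase the `ℓ₁` norm of a weakly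
sparse vector is small in `ℓ₁`. -/
theorem sum_abs_le_of_sparse {b h : Fin p → ℝ} {q s t c : ℝ} (hq0 : 0 ≤ q) (hq1 : q < 1)
    (ht : 0 < t) (hs : ∑ i, (if b i = 0 then 0 else |b i| ^ q) ≤ s) (hh : ∀ i, |h i| ≤ t)
    (hb : ∑ i, |b i + h i| ≤ ∑ i, |b i| + c) : ∑ i, |h i| ≤ 4 * (s * t ^ (1 - q)) + c := by
  have htq : 0 < t ^ (1 - q) := Real.rpow_pos_of_pos ht _
  -- Coordinatewise, `|h| + |b| - |b + h|` vanishes if `b = 0`, is at most `2t` if `|b| ≥ t`, and at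
  -- most `2|b|` if `|b| ≤ t`. In the last two cases `min t |b| ≤ t^(1-q) |b|^q`.
  have key : ∀ i, |h i| ≤ 4 * (t ^ (1 - q) * (if b i = 0 then 0 else |b i| ^ q))
      + (|b i + h i| - |b i|) := by
    intro i
    by_cases h0 : b i = 0
    · simp [h0]
    rw [if_neg h0]
    have hbp : 0 < |b i| := abs_pos.2 h0
    rcases le_total t |b i| with hle | hle
    · have h1 : t ≤ t ^ (1 - q) * |b i| ^ q := by
        calc t = t ^ (1 - q) * t ^ q := by rw [← Real.rpow_add ht]; simp
          _ ≤ _ := by gcongr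
      have h2 := abs_sub_abs_le_abs_sub (b i) (b i + h i)
      have h3 : |b i - (b i + h i)| = |h i| := by rw [sub_add_cancel_left, abs_neg]
      linarith [hh i]
    · have h1 : |b i| ≤ t ^ (1 - q) * |b i| ^ q := by
        calc |b i| = |b i| ^ (1 - q) * |b i| ^ q := by rw [← Real.rpow_add hbp]; simp
          _ ≤ _ := by
            gcongr
      have h2 := abs_sub_abs_le_abs_sub (h i) (-b i)
      rw [sub_neg_eq_add, abs_neg, add_comm (h i)] at h2
      linarith
  calc ∑ i, |h i| ≤ ∑ i, (4 * (t ^ (1 - q) * (if b i = 0 then 0 else |b i| ^ q))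
      + (|b i + h i| - |b i|)) := Finset.sum_le_sum fun i _ => key i
    _ = 4 * (t ^ (1 - q) * ∑ i, (if b i = 0 then 0 else |b i| ^ q))
      + (∑ i, |b i + h i| - ∑ i, |b i|) := by
        rw [Finset.sum_add_distrib, Finset.sum_sub_distrib, Finset.mul_sum, Finset.mul_sum]
    _ ≤ _ := by
        have := mul_le_mul_of_nonneg_left hs htq.le
        linarith

end Thresholding

/-! ### Deterministic analysis of SCIO -/

section Scio

variable {p : ℕ}

theorem scioObj_add {S : Matrix (Fin p) (Fin p) ℝ} (hS : S.IsSymm) (lam : ℝ) (i : Fin p)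
    (b h : Fin p → ℝ) :
    scioObj S lam i (b + h) = scioObj S lam i b + (S *ᵥ b - Pi.single i 1) ⬝ᵥ h
      + 1 / 2 * (h ⬝ᵥ (S *ᵥ h)) + lam * (∑ j, |b j + h j| - ∑ j, |b j|) := by
  have h1 : b ⬝ᵥ (S *ᵥ h) = (S *ᵥ b) ⬝ᵥ h := by
    rw [Matrix.dotProduct_mulVec, ← Matrix.mulVec_transpose, hS.eq]
  have h2 : h ⬝ᵥ (S *ᵥ b) = (S *ᵥ b) ⬝ᵥ h := dotProduct_comm _ _
  simp only [scioObj, Matrix.mulVec_add, dotProduct_add, add_dotProduct, sub_dotProduct, h1, h2,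
    Pi.add_apply]
  ring

/-- The stationarity condition of the SCIO problem. -/
theorem abs_mulVec_sub_single_le {S : Matrix (Fin p) (Fin p) ℝ} (hS : S.IsSymm) {lam : ℝ}
    {i : Fin p} {b : Fin p → ℝ} (hlam : 0 ≤ lam)
    (hb : IsMinOn (scioObj S lam i) Set.univ b) (j : Fin p) :
    |(S *ᵥ b - (Pi.single i 1 : Fin p → ℝ)) j| ≤ lam := by
  set g := (S *ᵥ b - (Pi.single i 1 : Fin p → ℝ)) j with hg
  -- Compare the minimizer with its perturbation by `u` in coordinate `j`.
  have key : ∀ u : ℝ, 0 ≤ u * g + 1 / 2 * u ^ 2 * S j j + lam * |u| := by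
    intro u
    have h1 : scioObj S lam i b ≤ scioObj S lam i (b + Pi.single j u) := hb (Set.mem_univ _)
    rw [scioObj_add hS] at h1
    have h2 : ∑ k, |b k + (Pi.single j u : Fin p → ℝ) k| ≤ ∑ k, |b k| + |u| := by
      calc _ ≤ ∑ k, (|b k| + |(Pi.single j u : Fin p → ℝ) k|) :=
            Finset.sum_le_sum fun k _ => abs_add_le _ _
        _ = ∑ k, |b k| + |u| := by
          rw [Finset.sum_add_distrib]
          congr 1
          rw [Finset.sum_eq_single j]
          · simp
          · intro k _ hk
            simp [hk]
          · simp
    have h3 : (Pi.single j u : Fin p → ℝ) ⬝ᵥ (S *ᵥ Pi.single j u) = u ^ 2 * S j j := by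
      simp
      ring
    have h4 : (S *ᵥ b - Pi.single i 1) ⬝ᵥ (Pi.single j u : Fin p → ℝ) = u * g := by
      rw [dotProduct_single, mul_comm]
    rw [h3, h4] at h1
    have := mul_le_mul_of_nonneg_left h2 hlam
    linarith
  have bound : ∀ σ : ℝ, |σ| = 1 → σ * g ≤ lam := by
    intro σ hσ
    have hσ2 : σ ^ 2 = 1 := by rw [← sq_abs, hσ, one_pow]
    refine le_of_forall_pos_le_add fun e he => ?_
    have hc : 0 < |S j j| + 1 := by positivity
    have hu : 0 < e / (|S j j| + 1) := by positivity
    -- A step short enough that the quadratic term, after division by the step, is at most `e / 2`.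
    set u := e / (|S j j| + 1) with hudef
    have h1 := key (-(u * σ))
    rw [abs_neg, abs_mul, hσ, abs_of_pos hu] at h1
    have h2 : 0 ≤ u * (lam + 1 / 2 * u * S j j - σ * g) := by
      have : (-(u * σ)) ^ 2 = u ^ 2 := by rw [neg_sq, mul_pow, hσ2, mul_one]
      rw [this] at h1
      linarith
    have h3 := nonneg_of_mul_nonneg_right h2 hu
    have h4 : u * S j j ≤ e := by
      calc u * S j j ≤ u * (|S j j| + 1) := by
            gcongr
            linarith [le_abs_self (S j j)]
        _ = e := by rw [hudef]; field_simp
    linarith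
  rw [abs_le]
  have h1 := bound 1 (by simp)
  have h2 := bound (-1) (by simp)
  constructor <;> linarith

variable {q s M lam δ : ℝ} {Sig S B A : Matrix (Fin p) (Fin p) ℝ}

/-- The quadratic term is nonnegative and the linear term is at least `-(lam / 2) |h|₁`, so
optimality limits the growth of the penalty. -/
theorem sum_abs_add_le_of_isMinOn (hS : S.PosSemidef) (hlam : 0 < lam) {i : Fin p}
    {b h : Fin p → ℝ} (hmin : IsMinOn (scioObj S lam i) Set.univ (b + h))
    (hb : ∀ j, |(S *ᵥ b - (Pi.single i 1 : Fin p → ℝ)) j| ≤ lam / 2) :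
    ∑ j, |b j + h j| ≤ ∑ j, |b j| + 1 / 2 * ∑ j, |h j| := by
  have h1 : scioObj S lam i (b + h) ≤ scioObj S lam i b := hmin (Set.mem_univ _)
  rw [scioObj_add (by simpa using hS.1)] at h1
  have h2 : 0 ≤ h ⬝ᵥ (S *ᵥ h) := by simpa using hS.dotProduct_mulVec_nonneg h
  have h3 := (abs_le.1 (abs_dotProduct_le (v := h) hb)).1
  have h4 : 0 ≤ lam * (∑ j, |b j| + 1 / 2 * ∑ j, |h j| - ∑ j, |b j + h j|) := by linarith
  linarith [nonneg_of_mul_nonneg_right h4 hlam]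

/-- Bounds on a single column of the SCIO estimate. -/
theorem scio_column_error (hdet : IsUnit Sig.det) (hΩ : SparseClass q s M Sig⁻¹)
    (hS : S.PosSemidef) (hlam : 0 < lam) (hδ : ∀ i j, |S i j - Sig i j| ≤ δ)
    (hδlam : 2 * (δ * M) ≤ lam) {i : Fin p} {b : Fin p → ℝ}
    (hb : IsMinOn (scioObj S lam i) Set.univ b) :
    (∀ j, |b j - Sig⁻¹ j i| ≤ 3 * M * lam) ∧
      ∑ j, |b j| ≤ ∑ j, |Sig⁻¹ j i| + 1 / 2 * ∑ j, |b j - Sig⁻¹ j i| := by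
  have hM : 0 < M := (hΩ.pos i).2
  have hδ0 : 0 ≤ δ := (abs_nonneg _).trans (hδ i i)
  set w : Fin p → ℝ := fun j => Sig⁻¹ j i with hw
  have hwM : ∑ j, |w j| ≤ M := (sum_abs_le_l1Norm _ i).trans hΩ.l1_le
  have hSw : Sig *ᵥ w = Pi.single i 1 := by
    have : w = Sig⁻¹ *ᵥ Pi.single i 1 := by ext j; simp [hw]
    rw [this, Matrix.mulVec_mulVec, Matrix.mul_nonsing_inv _ hdet, Matrix.one_mulVec]
  have hdiff : ∀ v : Fin p → ℝ, ∀ j, |((S - Sig) *ᵥ v) j| ≤ δ * ∑ k, |v k| := fun v j =>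
    abs_dotProduct_le (u := fun k => (S - Sig) j k) fun k => hδ j k
  have hgrad : ∀ j, |(S *ᵥ w - (Pi.single i 1 : Fin p → ℝ)) j| ≤ lam / 2 := by
    intro j
    rw [← hSw, ← Matrix.sub_mulVec]
    refine (hdiff w j).trans ?_
    have := mul_le_mul_of_nonneg_left hwM hδ0
    linarith
  have hsplit : w + (b - w) = b := add_sub_cancel w b
  have hbasic := sum_abs_add_le_of_isMinOn (h := b - w) hS hlam (hsplit.symm ▸ hb) hgrad
  have hbasic' : ∑ j, |b j| ≤ ∑ j, |w j| + 1 / 2 * ∑ j, |b j - w j| := by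
    simpa using hbasic
  refine ⟨?_, hbasic'⟩
  have htri : ∑ j, |b j - w j| ≤ ∑ j, |b j| + ∑ j, |w j| := by
    rw [← Finset.sum_add_distrib]
    exact Finset.sum_le_sum fun j _ => abs_sub _ _
  -- Inserting `htri` into `hbasic'` gives `|b|₁ ≤ 3 |w|₁`.
  have hbM : ∑ j, |b j| ≤ 3 * M := by linarith
  -- Stationarity contributes `lam`, and replacing `S` by `Sig` costs `3Mδ ≤ 3 lam / 2`.
  have hSigh : ∀ j, |(Sig *ᵥ (b - w)) j| ≤ 3 * lam := by
    intro j
    have e : Sig *ᵥ (b - w) = (S *ᵥ b - Pi.single i 1) - (S - Sig) *ᵥ b := by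
      rw [Matrix.mulVec_sub, hSw, Matrix.sub_mulVec]
      abel
    have h1 := abs_mulVec_sub_single_le (by simpa using hS.1) hlam.le hb j
    have h2 := (hdiff b j).trans (mul_le_mul_of_nonneg_left hbM hδ0)
    rw [e, Pi.sub_apply]
    refine (abs_sub _ _).trans ?_
    linarith
  intro j
  have hinv : b - w = Sig⁻¹ *ᵥ (Sig *ᵥ (b - w)) := by
    rw [Matrix.mulVec_mulVec, Matrix.nonsing_inv_mul _ hdet, Matrix.one_mulVec]
  have hsymm : ∀ k, Sig⁻¹ j k = Sig⁻¹ k j := fun k => by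
    simpa using hΩ.posDef.1.apply k j
  have h1 : |b j - w j| ≤ 3 * lam * ∑ k, |Sig⁻¹ j k| := by
    have : b j - w j = (Sig *ᵥ (b - w)) ⬝ᵥ (fun k => Sig⁻¹ j k) := by
      rw [dotProduct_comm]
      exact congrFun hinv j
    rw [this]
    exact abs_dotProduct_le hSigh
  have h2 : ∑ k, |Sig⁻¹ j k| ≤ M := by
    simp_rw [hsymm]
    exact (sum_abs_le_l1Norm _ j).trans hΩ.l1_le
  calc |b j - w j| ≤ 3 * lam * M := h1.trans (by gcongr)
    _ = 3 * M * lam := by ring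

/-- Deterministic error bounds for the SCIO estimate. -/
theorem scio_error (hq0 : 0 ≤ q) (hq1 : q < 1) (hdet : IsUnit Sig.det)
    (hΩ : SparseClass q s M Sig⁻¹) (hS : S.PosSemidef) (hM : 0 < M) (hlam : 0 < lam) (hs : 0 < s)
    (hδ : ∀ i j, |S i j - Sig i j| ≤ δ) (hδlam : 2 * (δ * M) ≤ lam) (hA : IsScio S lam A) :
    maxNorm (A - Sig⁻¹) ≤ 3 * M * lam ∧
      l1Norm (A - Sig⁻¹) ≤ 8 * (s * (3 * M * lam) ^ (1 - q)) := by
  obtain ⟨B, hB, hAsymm, hAB⟩ := hA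
  have ht : 0 < 3 * M * lam := by positivity
  have hcol := fun i => scio_column_error hdet hΩ hS hlam hδ hδlam (hB i)
  have hsymm : ∀ i j, Sig⁻¹ i j = Sig⁻¹ j i := fun i j => by
    simpa using hΩ.posDef.1.apply j i
  have hentry : ∀ i j, |A i j - Sig⁻¹ i j| ≤ 3 * M * lam := by
    intro i j
    rcases (hAB i j).1 with h | h
    · rw [h]
      exact (hcol j).1 i
    · rw [h, hsymm]
      exact (hcol i).1 j
  refine ⟨maxNorm_le ht.le hentry, l1Norm_le (by positivity) fun j => ?_⟩
  have hBsum : ∑ i, |B i j - Sig⁻¹ i j| ≤ 8 * (s * (3 * M * lam) ^ (1 - q)) := by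
    -- Here `c` is half the left-hand side; absorbing it doubles the constant 4 to 8.
    have := sum_abs_le_of_sparse (b := fun i => Sig⁻¹ i j) (h := fun i => B i j - Sig⁻¹ i j)
      hq0 hq1 ht (hΩ.sparse j) (hcol j).1 (by simpa using (hcol j).2)
    linarith
  -- Choosing the smaller entry cannot increase a column's `ℓ₁` norm, so the inequality for `B`
  -- passes to `A`, with `c` now at most `4 s t^(1-q)`, where `t = 3Mλ`.
  have hAB' : ∑ i, |A i j| ≤ ∑ i, |B i j| := Finset.sum_le_sum fun i _ => by
    rw [(hAB i j).2]
    exact min_le_left _ _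
  have := sum_abs_le_of_sparse (b := fun i => Sig⁻¹ i j) (h := fun i => A i j - Sig⁻¹ i j)
    (c := 1 / 2 * ∑ i, |B i j - Sig⁻¹ i j|) hq0 hq1 ht (hΩ.sparse j) (fun i => hentry i j)
    (by simpa using hAB'.trans (hcol j).2)
  simp only [Matrix.sub_apply]
  linarith

end Scio

/-! ### Existence of the estimator -/

section Existence

variable {p : ℕ}

theorem continuous_huberPsi (H : ℝ) : Continuous (huberPsi H) := by
  unfold huberPsi
  fun_prop

theorem huberPsi_mono (H : ℝ) : Monotone (huberPsi H) := fun _ _ h =>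
  min_le_min_left _ (max_le_max_left _ h)

theorem huberPsi_neg {H : ℝ} (hH : 0 ≤ H) (x : ℝ) : huberPsi H (-x) = -huberPsi H x := by
  simp only [huberPsi, min_def, max_def]
  split_ifs <;> linarith

theorem exists_sum_huberPsi_eq_zero {n : ℕ} {H : ℝ} (hH : 0 < H) (y : Fin n → ℝ) :
    ∃ m, ∑ k, huberPsi H (y k - m) = 0 := by
  have hcont : Continuous fun m => ∑ k, huberPsi H (y k - m) :=
    continuous_finsetSum _ fun k _ => (continuous_huberPsi H).comp (by fun_prop)
  have hy : ∀ k, |y k| ≤ ∑ k, |y k| := fun k =>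
    Finset.single_le_sum (f := fun k => |y k|) (fun _ _ => abs_nonneg _) (Finset.mem_univ k)
  -- Intermediate value theorem: at `±∑ |y k|` all residuals have the same sign.
  refine mem_range_of_exists_le_of_exists_ge hcont ⟨∑ k, |y k|, ?_⟩ ⟨-∑ k, |y k|, ?_⟩
  · refine Finset.sum_nonpos fun k _ => min_le_of_right_le (max_le (by linarith) ?_)
    linarith [le_abs_self (y k), hy k]
  · refine Finset.sum_nonneg fun k _ => le_min hH.le (le_max_of_le_right ?_)
    linarith [neg_abs_le (y k), hy k]

theorem isClosed_setOf_mem_psdCone (ε : ℝ) :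
    IsClosed {T : Fin p → Fin p → ℝ | Matrix.of T ∈ psdCone p ε} := by
  have hset : {T : Fin p → Fin p → ℝ | Matrix.of T ∈ psdCone p ε} =
      {T | (Matrix.of T)ᵀ = Matrix.of T} ∩
        ⋂ x : Fin p → ℝ, {T | 0 ≤ x ⬝ᵥ ((Matrix.of T - ε • (1 : Matrix (Fin p) (Fin p) ℝ)) *ᵥ x)} := by
    ext T
    simp [psdCone, Matrix.posSemidef_iff_dotProduct_mulVec, Matrix.IsHermitian]
  have hof : Continuous fun T : Fin p → Fin p → ℝ => Matrix.of T := continuous_id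
  rw [hset]
  refine (isClosed_eq hof.matrix_transpose hof).inter (isClosed_iInter fun x => ?_)
  refine isClosed_le continuous_const ?_
  exact Continuous.dotProduct continuous_const
    (Continuous.matrix_mulVec (hof.sub continuous_const) continuous_const)

theorem exists_isConeProjection (ε : ℝ) (S : Matrix (Fin p) (Fin p) ℝ) :
    ∃ T, IsConeProjection ε S T := by
  have hne : {T : Fin p → Fin p → ℝ | Matrix.of T ∈ psdCone p ε}.Nonempty := by
    refine ⟨ε • (1 : Matrix (Fin p) (Fin p) ℝ), ?_⟩
    change (ε • (1 : Matrix (Fin p) (Fin p) ℝ)) ∈ psdCone p ε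
    simpa [psdCone] using Matrix.PosSemidef.zero
  obtain ⟨T, hT, hdist⟩ := (isClosed_setOf_mem_psdCone ε).exists_infDist_eq_dist hne
    (Matrix.of.symm S)
  refine ⟨Matrix.of T, hT, fun T' hT' => ?_⟩
  have h1 : dist (Matrix.of.symm S) T ≤ dist (Matrix.of.symm S) (Matrix.of.symm T') := by
    rw [← hdist]
    exact Metric.infDist_le_dist_of_mem hT'
  rw [dist_comm, dist_comm _ (Matrix.of.symm T'), dist_eq_norm, dist_eq_norm,
    ← maxNorm_eq_norm, ← maxNorm_eq_norm] at h1
  exact h1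

theorem le_dotProduct_mulVec_of_mem_psdCone {ε : ℝ} {S : Matrix (Fin p) (Fin p) ℝ}
    (hS : S ∈ psdCone p ε) (x : Fin p → ℝ) : ε * (x ⬝ᵥ x) ≤ x ⬝ᵥ (S *ᵥ x) := by
  have h := hS.dotProduct_mulVec_nonneg x
  simp only [star_trivial, Matrix.sub_mulVec, Matrix.smul_mulVec, Matrix.one_mulVec,
    dotProduct_sub, dotProduct_smul, smul_eq_mul] at h
  linarith

theorem posSemidef_of_mem_psdCone {ε : ℝ} (hε : 0 ≤ ε) {S : Matrix (Fin p) (Fin p) ℝ}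
    (hS : S ∈ psdCone p ε) : S.PosSemidef := by
  have h : (ε • (1 : Matrix (Fin p) (Fin p) ℝ)).PosSemidef := Matrix.PosSemidef.one.smul hε
  have h2 : (S - ε • (1 : Matrix (Fin p) (Fin p) ℝ)).PosSemidef := hS
  simpa using h2.add h

theorem exists_isMinOn_scioObj {ε lam : ℝ} (hε : 0 < ε) (hlam : 0 ≤ lam)
    {S : Matrix (Fin p) (Fin p) ℝ} (hS : S ∈ psdCone p ε) (i : Fin p) :
    ∃ b, IsMinOn (scioObj S lam i) Set.univ b := by
  have hcont : Continuous (scioObj S lam i) := by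
    unfold scioObj
    refine ((continuous_const.mul (Continuous.dotProduct continuous_id
      (Continuous.matrix_mulVec continuous_const continuous_id))).sub
      (Continuous.dotProduct continuous_const continuous_id)).add ?_
    fun_prop
  -- Coercivity: of the `ε / 2` from the quadratic form, one half controls `‖b‖²` and the other
  -- absorbs the linear term, at cost `1 / ε`.
  have hlower : ∀ b : Fin p → ℝ, ε / 4 * ‖b‖ ^ 2 - 1 / ε ≤ scioObj S lam i b := by
    intro b
    have h1 := le_dotProduct_mulVec_of_mem_psdCone hS b
    have h2 : 0 ≤ lam * ∑ j, |b j| :=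
      mul_nonneg hlam (Finset.sum_nonneg fun _ _ => abs_nonneg _)
    have hsq : ∀ j, b j ^ 2 ≤ b ⬝ᵥ b := fun j => by
      rw [pow_two]
      exact Finset.single_le_sum (f := fun j => b j * b j) (fun _ _ => mul_self_nonneg _)
        (Finset.mem_univ j)
    have h3 : ‖b‖ ^ 2 ≤ b ⬝ᵥ b := by
      have h0 : 0 ≤ b ⬝ᵥ b := (sq_nonneg _).trans (hsq i)
      have : ‖b‖ ≤ √(b ⬝ᵥ b) := (pi_norm_le_iff_of_nonneg (Real.sqrt_nonneg _)).2 fun j =>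
        Real.abs_le_sqrt (hsq j)
      calc ‖b‖ ^ 2 ≤ √(b ⬝ᵥ b) ^ 2 := by gcongr
        _ = b ⬝ᵥ b := Real.sq_sqrt h0
    have h4 : b i ≤ ε / 4 * b i ^ 2 + 1 / ε := by
      have : 0 ≤ (ε * b i - 2) ^ 2 / (4 * ε) := by positivity
      have e : (ε * b i - 2) ^ 2 / (4 * ε) = ε / 4 * b i ^ 2 + 1 / ε - b i := by
        field_simp
        ring
      linarith
    have h5 := mul_le_mul_of_nonneg_left (hsq i) hε.le
    have h6 := mul_le_mul_of_nonneg_left h3 hε.le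
    have h7 : (Pi.single i 1 : Fin p → ℝ) ⬝ᵥ b = b i := by simp
    rw [scioObj, h7]
    linarith
  have htends : Tendsto (scioObj S lam i) (cocompact _) atTop := by
    refine tendsto_atTop_mono hlower ?_
    refine tendsto_atTop_add_const_right _ _ ?_
    exact ((tendsto_pow_atTop two_ne_zero).comp
      (tendsto_norm_cocompact_atTop (E := Fin p → ℝ))).const_mul_atTop (by positivity)
  obtain ⟨b, hb⟩ := hcont.exists_forall_le htends
  exact ⟨b, fun y _ => hb y⟩

theorem exists_isSymmetrization (B : Matrix (Fin p) (Fin p) ℝ) : ∃ A, IsSymmetrization B A := by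
  -- Tied entries may differ in sign; always taking the upper-triangular one keeps the matrix
  -- symmetric.
  refine ⟨Matrix.of fun i j => if |B i j| < |B j i| then B i j else
    if |B j i| < |B i j| then B j i else if i ≤ j then B i j else B j i, ?_, fun i j => ?_⟩
  · ext i j
    simp only [Matrix.transpose_apply, Matrix.of_apply]
    split_ifs <;> first | rfl | (exfalso; order) | skip
    have : i = j := by order
    rw [this]
  · simp only [Matrix.of_apply]
    constructor
    · split_ifs <;> simp
    · split_ifs with h1 h2 h3
      · rw [min_eq_left h1.le]
      · rw [min_eq_right h2.le]
      · rw [min_eq_left (not_lt.1 h2)]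
      · rw [min_eq_right (not_lt.1 h1)]

theorem exists_isScio {ε lam : ℝ} (hε : 0 < ε) (hlam : 0 ≤ lam)
    {S : Matrix (Fin p) (Fin p) ℝ} (hS : S ∈ psdCone p ε) : ∃ A, IsScio S lam A := by
  choose b hb using fun i => exists_isMinOn_scioObj hε hlam hS i
  obtain ⟨A, hA⟩ := exists_isSymmetrization (Matrix.of fun j i => b i j)
  exact ⟨A, _, hb, hA⟩

/-- The robust SCIO estimator exists for every sample. -/
theorem exists_isRobustScio {n : ℕ} {H ε lam : ℝ} (hH : 0 < H) (hε : 0 < ε) (hlam : 0 ≤ lam)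
    (x : Fin n → Fin p → ℝ) : ∃ A, IsRobustScio H ε lam x A := by
  choose m hm using fun i => exists_sum_huberPsi_eq_zero hH fun k => x k i
  choose c hc using fun i j => exists_sum_huberPsi_eq_zero hH fun k => x k i * x k j
  obtain ⟨S, hS⟩ := exists_isConeProjection ε (Matrix.of fun i j => c i j - m i * m j)
  obtain ⟨A, hA⟩ := exists_isScio hε hlam hS.1
  refine ⟨A, S, ⟨m, _, hm, fun i j => ?_, hS⟩, hA⟩
  simpa using hc i j

end Existence

/-! ### Deviation of Huber estimates -/

section Concentration

theorem exp_huberPsi_div_le {H : ℝ} (hH : 0 < H) (y : ℝ) :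
    Real.exp (huberPsi H y / H) ≤ 1 + y / H + 2 * (y / H) ^ 2 := by
  obtain ⟨x, rfl⟩ : ∃ x, y = x * H := ⟨y / H, by field_simp⟩
  rw [mul_div_cancel_right₀ _ hH.ne']
  have hexp : ∀ c : ℝ, |c| ≤ 1 → Real.exp c ≤ 1 + c + c ^ 2 := fun c hc => by
    have := (abs_le.1 (Real.abs_exp_sub_one_sub_id_le hc)).2
    linarith
  unfold huberPsi
  rcases le_total x (-1) with h | h
  · rw [max_eq_left (by nlinarith), min_eq_right (by linarith), neg_div, div_self hH.ne']
    have := hexp (-1) (by simp)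
    nlinarith
  rw [max_eq_right (by nlinarith)]
  rcases le_total x 1 with h' | h'
  · rw [min_eq_right (by nlinarith), mul_div_cancel_right₀ _ hH.ne']
    have := hexp x (abs_le.2 ⟨h, h'⟩)
    nlinarith
  · rw [min_eq_left (by nlinarith), div_self hH.ne']
    have := hexp 1 (by simp)
    nlinarith

theorem abs_huberPsi_le {H : ℝ} (hH : 0 ≤ H) (y : ℝ) : |huberPsi H y| ≤ H :=
  abs_le.2 ⟨le_min (by linarith) (le_max_left _ _), min_le_left _ _⟩

variable {n : ℕ} {E 𝓧 : Type*} [MeasurableSpace E] [MeasurableSpace 𝓧] {P : Measure E}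
  {Pr : Measure 𝓧} [IsProbabilityMeasure P] [IsProbabilityMeasure Pr] {X : Fin n → 𝓧 → E}
  {g : E → ℝ} {V r H : ℝ}

/-- Integrating the quadratic majorant, the shift `r` produces the negative drift `-r / H`, and the
second-order term is the variance plus `r²`. -/
theorem integral_exp_huberPsi_le (hg : Measurable g) (hg2 : MemLp g 2 P)
    (hV : ∫ x, g x ^ 2 ∂P ≤ V) (hH : 0 < H) :
    ∫ x, Real.exp (huberPsi H (g x - (∫ x, g x ∂P + r)) / H) ∂P ≤
      Real.exp (-(r / H) + 2 * ((V + r ^ 2) / H ^ 2)) := by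
  set m := ∫ x, g x ∂P with hm
  have hgi : Integrable g P := hg2.integrable (by norm_num)
  have hg2i : Integrable (fun x => g x ^ 2) P := hg2.integrable_sq
  have hquad : ∀ x, 1 + (g x - (m + r)) / H + 2 * ((g x - (m + r)) / H) ^ 2 =
      (1 - (m + r) / H + 2 * ((m + r) / H) ^ 2) + (1 / H - 4 * (m + r) / H ^ 2) * g x
        + 2 / H ^ 2 * g x ^ 2 := fun x => by
    field_simp
    ring
  have hi1 : Integrable (fun x => (1 - (m + r) / H + 2 * ((m + r) / H) ^ 2)
      + (1 / H - 4 * (m + r) / H ^ 2) * g x) P := (integrable_const _).add (hgi.const_mul _)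
  have hi2 : Integrable (fun x => 2 / H ^ 2 * g x ^ 2) P := hg2i.const_mul _
  have hmeas : Measurable fun x => Real.exp (huberPsi H (g x - (m + r)) / H) :=
    Real.measurable_exp.comp
      (((continuous_huberPsi H).measurable.comp (hg.sub_const _)).div_const _)
  have hint : Integrable (fun x => Real.exp (huberPsi H (g x - (m + r)) / H)) P := by
    refine Integrable.of_bound hmeas.aestronglyMeasurable (Real.exp 1) (ae_of_all _ fun x => ?_)
    rw [Real.norm_eq_abs, Real.abs_exp, Real.exp_le_exp, div_le_one hH]
    exact (le_abs_self _).trans (abs_huberPsi_le hH.le _)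
  calc ∫ x, Real.exp (huberPsi H (g x - (m + r)) / H) ∂P
      ≤ ∫ x, ((1 - (m + r) / H + 2 * ((m + r) / H) ^ 2)
        + (1 / H - 4 * (m + r) / H ^ 2) * g x + 2 / H ^ 2 * g x ^ 2) ∂P := by
        refine integral_mono hint (hi1.add hi2) fun x => ?_
        exact (exp_huberPsi_div_le hH _).trans (hquad x).le
    _ = 1 - r / H + 2 * ((∫ x, g x ^ 2 ∂P - m ^ 2 + r ^ 2) / H ^ 2) := by
        rw [integral_add hi1 hi2, integral_add (integrable_const _) (hgi.const_mul _),
          integral_const, integral_const_mul, integral_const_mul, ← hm]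
        simp only [probReal_univ, one_smul]
        field_simp
        ring
    _ ≤ 1 + (-(r / H) + 2 * ((V + r ^ 2) / H ^ 2)) := by
        have : (∫ x, g x ^ 2 ∂P - m ^ 2 + r ^ 2) / H ^ 2 ≤ (V + r ^ 2) / H ^ 2 := by
          gcongr
          linarith [sq_nonneg m]
        linarith
    _ ≤ _ := by
        rw [add_comm]
        exact Real.add_one_le_exp _

/-- Chernoff's bound at parameter 1 for the sum of the independent variables `ψ_H / H`. -/
theorem measureReal_sum_huberPsi_nonneg_le (hX : ∀ k, HasLaw (X k) P Pr) (hind : iIndepFun X Pr)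
    (hg : Measurable g) (hg2 : MemLp g 2 P) (hV : ∫ x, g x ^ 2 ∂P ≤ V) (hH : 0 < H) :
    Pr.real {ω | 0 ≤ ∑ k, huberPsi H (g (X k ω) - (∫ x, g x ∂P + r))} ≤
      Real.exp (n * (-(r / H) + 2 * ((V + r ^ 2) / H ^ 2))) := by
  set φ : E → ℝ := fun x => huberPsi H (g x - (∫ x, g x ∂P + r)) / H with hφ
  have hφm : Measurable φ :=
    ((continuous_huberPsi H).measurable.comp (hg.sub_const _)).div_const _
  have hφ1 : ∀ x, |φ x| ≤ 1 := fun x => by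
    rw [hφ, abs_div, abs_of_pos hH, div_le_one hH]
    exact abs_huberPsi_le hH.le _
  have hWm : ∀ k, AEMeasurable (φ ∘ X k) Pr := fun k => hφm.comp_aemeasurable (hX k).aemeasurable
  have hset : {ω | 0 ≤ ∑ k, huberPsi H (g (X k ω) - (∫ x, g x ∂P + r))} =
      {ω | 0 ≤ (∑ k, φ ∘ X k) ω} := by
    ext ω
    have : (∑ k, φ ∘ X k) ω = (∑ k, huberPsi H (g (X k ω) - (∫ x, g x ∂P + r))) / H := by
      rw [Finset.sum_apply, Finset.sum_div]
      rfl
    rw [Set.mem_ofPred_eq, Set.mem_ofPred_eq, this]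
    constructor
    · intro h
      positivity
    · intro h
      have := mul_nonneg h hH.le
      rwa [div_mul_cancel₀ _ hH.ne'] at this
  have hint : Integrable (fun ω => Real.exp (1 * (∑ k, φ ∘ X k) ω)) Pr := by
    have hm : AEMeasurable (∑ k, φ ∘ X k) Pr := Finset.aemeasurable_sum _ fun k _ => hWm k
    refine Integrable.of_bound
      (Real.measurable_exp.comp_aemeasurable (hm.const_mul 1)).aestronglyMeasurable
      (Real.exp n) (ae_of_all _ fun ω => ?_)
    rw [Real.norm_eq_abs, Real.abs_exp, Real.exp_le_exp, one_mul, Finset.sum_apply]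
    calc ∑ k, (φ ∘ X k) ω ≤ ∑ k : Fin n, (1 : ℝ) :=
          Finset.sum_le_sum fun k _ => (le_abs_self _).trans (hφ1 _)
      _ = n := by simp
  have hmgf : ∀ k, mgf (φ ∘ X k) Pr 1 ≤ Real.exp (-(r / H) + 2 * ((V + r ^ 2) / H ^ 2)) := by
    intro k
    have h := (hX k).integral_comp (f := fun x => Real.exp (φ x))
      (Real.measurable_exp.comp hφm).aestronglyMeasurable
    rw [mgf]
    simp only [one_mul]
    exact h.le.trans (integral_exp_huberPsi_le hg hg2 hV hH)
  rw [hset]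
  refine (measure_ge_le_exp_mul_mgf (t := 1) 0 zero_le_one hint).trans ?_
  rw [mul_zero, Real.exp_zero, one_mul,
    (hind.comp (fun _ => φ) fun _ => hφm).mgf_sum₀ hWm Finset.univ]
  calc ∏ k, mgf (φ ∘ X k) Pr 1
      ≤ ∏ _k : Fin n, Real.exp (-(r / H) + 2 * ((V + r ^ 2) / H ^ 2)) :=
        Finset.prod_le_prod (fun k _ => mgf_nonneg) fun k _ => hmgf k
    _ = _ := by rw [Finset.prod_const, Finset.card_univ, Fintype.card_fin, ← Real.exp_nat_mul]

/-- Exponential deviation inequality for all Huber estimates of a mean. -/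
theorem measureReal_huber_root_far_le (hX : ∀ k, HasLaw (X k) P Pr) (hind : iIndepFun X Pr)
    (hg : Measurable g) (hg2 : MemLp g 2 P) (hV : ∫ x, g x ^ 2 ∂P ≤ V) (hH : 0 < H) :
    Pr.real {ω | ∃ m, ∑ k, huberPsi H (g (X k ω) - m) = 0 ∧ r ≤ |m - ∫ x, g x ∂P|} ≤
      2 * Real.exp (n * (-(r / H) + 2 * ((V + r ^ 2) / H ^ 2))) := by
  have h1 := measureReal_sum_huberPsi_nonneg_le (r := r) hX hind hg hg2 hV hH
  -- Since `ψ_H` is odd, the lower tail is the upper tail for `-g`. By monotonicity, a root beyond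
  -- mean `± r` fixes the sign of the sum there, so one event covers all roots.
  have h2 := measureReal_sum_huberPsi_nonneg_le (r := r) (g := fun x => -g x) hX hind hg.neg
    hg2.neg (by simpa using hV) hH
  refine (measureReal_mono (s₂ := _ ∪ _) ?_ (measure_ne_top _ _)).trans
    ((measureReal_union_le _ _).trans ((add_le_add h1 h2).trans (two_mul _).ge))
  rintro ω ⟨m, hm, hr⟩
  rw [Set.mem_union, Set.mem_ofPred_eq, Set.mem_ofPred_eq]
  rcases le_abs.1 hr with h | h
  · left
    rw [← hm]
    exact Finset.sum_le_sum fun k _ => huberPsi_mono H (by linarith)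
  · right
    rw [integral_neg]
    calc (0 : ℝ) = ∑ k, huberPsi H (-(g (X k ω) - m)) := by
          simp_rw [huberPsi_neg hH.le]
          rw [Finset.sum_neg_distrib, hm, neg_zero]
      _ ≤ _ := Finset.sum_le_sum fun k _ => huberPsi_mono H (by linarith)

/-- With `H = κ (n / log p)^{1/2}`, Huber estimates of a mean deviate by a multiple of
`(log p / n)^{1/2}` only with probability of order `p^{-β}`. -/
theorem measure_huber_root_far_le_rpow {p : ℕ} {κ β C : ℝ} (hp : 2 ≤ p) (hn : 0 < n) (hκ : 0 < κ)
    (hC : C = κ * β + 2 * (V + 1) / κ) (hsmall : (C * √(Real.log p / n)) ^ 2 ≤ 1)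
    (hX : ∀ k, HasLaw (X k) P Pr) (hind : iIndepFun X Pr)
    (hg : Measurable g) (hg2 : MemLp g 2 P) (hV : ∫ x, g x ^ 2 ∂P ≤ V) :
    Pr {ω | ∃ m, ∑ k, huberPsi (κ * ((n : ℝ) / Real.log p) ^ (1 / 2 : ℝ)) (g (X k ω) - m) = 0 ∧
      C * √(Real.log p / n) ≤ |m - ∫ x, g x ∂P|} ≤ ENNReal.ofReal (2 * (p : ℝ) ^ (-β)) := by
  have hp1 : (1 : ℝ) < p := by exact_mod_cast hp
  have hlog : 0 < Real.log p := Real.log_pos hp1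
  have hn' : (0 : ℝ) < n := by exact_mod_cast hn
  set a := √(Real.log p / n) with ha
  have hapos : 0 < a := Real.sqrt_pos.2 (by positivity)
  have hH : κ * ((n : ℝ) / Real.log p) ^ (1 / 2 : ℝ) = κ / a := by
    rw [← Real.sqrt_eq_rpow, ← inv_div, Real.sqrt_inv, ← ha, div_eq_mul_inv κ]
  have hna : n * a ^ 2 = Real.log p := by
    rw [ha, Real.sq_sqrt (by positivity)]
    field_simp
  rw [hH]
  have h := measureReal_huber_root_far_le (r := C * a) hX hind hg hg2 hV
    (div_pos hκ hapos : 0 < κ / a)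
  -- As `n a² = log p`, the choice of `C` leaves exactly `-β log p` once `(C a)²` is replaced by 1.
  have hexp : n * (-(C * a / (κ / a)) + 2 * ((V + (C * a) ^ 2) / (κ / a) ^ 2)) ≤
      Real.log p * (-β) := by
    calc n * (-(C * a / (κ / a)) + 2 * ((V + (C * a) ^ 2) / (κ / a) ^ 2))
        = (n * a ^ 2) * (-(C / κ) + 2 * ((V + (C * a) ^ 2) / κ ^ 2)) := by
          field_simp
      _ ≤ (n * a ^ 2) * (-(C / κ) + 2 * ((V + 1) / κ ^ 2)) := by gcongr
      _ = Real.log p * (-β) := by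
          rw [hna, hC]
          field_simp
          ring
  rw [← ofReal_measureReal]
  refine ENNReal.ofReal_le_ofReal (h.trans ?_)
  rw [Real.rpow_def_of_pos (by positivity)]
  gcongr

end Concentration

/-! ### Moment bounds from the fourth-moment condition -/

section Moments

variable {p : ℕ} {K R : ℝ} {P : Measure (Fin p → ℝ)}

theorem integrable_pow_four {Ω : Type*} [MeasurableSpace Ω] {μ : Measure Ω}
    {f : Ω → ℝ} (hf : MemLp f 4 μ) : Integrable (fun x => f x ^ 4) μ := by
  have h := hf.integrable_norm_pow (p := 4) (by norm_num)
  refine h.congr (ae_of_all _ fun x => ?_)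
  simp only [Real.norm_eq_abs]
  exact Even.pow_abs (by decide) _

theorem integral_pow_four_le [IsProbabilityMeasure P] (hP : BoundedFourthMoments K P) (hR : ∀ i, |popMean P i| ≤ R)
    (i : Fin p) : ∫ x, x i ^ 4 ∂P ≤ 8 * (K + R ^ 4) := by
  have hc : Integrable (fun x : Fin p → ℝ => (x i - popMean P i) ^ 4) P :=
    integrable_pow_four ((hP i).1.sub (memLp_const _))
  have hle : ∀ x : Fin p → ℝ, x i ^ 4 ≤ 8 * (x i - popMean P i) ^ 4 + 8 * R ^ 4 := by
    intro x
    have h1 : popMean P i ^ 4 ≤ R ^ 4 := by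
      rw [← Even.pow_abs (by decide : Even 4) (popMean P i)]
      exact pow_le_pow_left₀ (abs_nonneg _) (hR i) 4
    have h2 : ∀ a b : ℝ, (a + b) ^ 4 ≤ 8 * a ^ 4 + 8 * b ^ 4 := fun a b => by
      have h3 : (a + b) ^ 2 ≤ 2 * (a ^ 2 + b ^ 2) := add_sq_le
      have h4 : (a ^ 2 + b ^ 2) ^ 2 ≤ 2 * ((a ^ 2) ^ 2 + (b ^ 2) ^ 2) := add_sq_le
      have h5 := pow_le_pow_left₀ (sq_nonneg (a + b)) h3 2
      linarith
    have h3 := h2 (x i - popMean P i) (popMean P i)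
    rw [sub_add_cancel] at h3
    linarith
  calc ∫ x, x i ^ 4 ∂P ≤ ∫ x, (8 * (x i - popMean P i) ^ 4 + 8 * R ^ 4) ∂P :=
        integral_mono (integrable_pow_four (hP i).1)
          ((hc.const_mul 8).add (integrable_const _)) hle
    _ = 8 * ∫ x, (x i - popMean P i) ^ 4 ∂P + 8 * R ^ 4 := by
        rw [integral_add (hc.const_mul 8) (integrable_const _), integral_const_mul,
          integral_const]
        simp
    _ ≤ _ := by linarith [(hP i).2]

theorem integral_sq_le [IsProbabilityMeasure P] (hP : BoundedFourthMoments K P) (hR : ∀ i, |popMean P i| ≤ R)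
    (i : Fin p) : ∫ x, x i ^ 2 ∂P ≤ 1 + 8 * (K + R ^ 4) := by
  have h4 := integrable_pow_four (hP i).1
  have h2 : MemLp (fun x : Fin p → ℝ => x i) 2 P := (hP i).1.mono_exponent (by norm_num)
  calc ∫ x, x i ^ 2 ∂P ≤ ∫ x, (1 + x i ^ 4) ∂P :=
        integral_mono h2.integrable_sq ((integrable_const _).add h4) fun x => by
          nlinarith [sq_nonneg (x i ^ 2 - 1), sq_nonneg (x i)]
    _ = 1 + ∫ x, x i ^ 4 ∂P := by
        rw [integral_add (integrable_const _) h4, integral_const]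
        simp
    _ ≤ _ := by linarith [integral_pow_four_le hP hR i]

/-- Products of coordinates are square integrable. -/
theorem memLp_mul (hP : BoundedFourthMoments K P) (i j : Fin p) :
    MemLp (fun x : Fin p → ℝ => x i * x j) 2 P ∧
      ∫ x, (x i * x j) ^ 2 ∂P ≤ 1 / 2 * (∫ x, x i ^ 4 ∂P + ∫ x, x j ^ 4 ∂P) := by
  have hi := integrable_pow_four (hP i).1
  have hj := integrable_pow_four (hP j).1
  have hm : Measurable fun x : Fin p → ℝ => x i * x j := by fun_prop
  have hle : ∀ x : Fin p → ℝ, (x i * x j) ^ 2 ≤ 1 / 2 * (x i ^ 4 + x j ^ 4) := fun x => by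
    nlinarith [sq_nonneg (x i ^ 2 - x j ^ 2)]
  have hint : Integrable (fun x : Fin p → ℝ => (x i * x j) ^ 2) P := by
    refine ((hi.add hj).const_mul (1 / 2)).mono' (hm.pow_const 2).aestronglyMeasurable
      (ae_of_all _ fun x => ?_)
    rw [Real.norm_eq_abs, abs_of_nonneg (sq_nonneg _)]
    exact hle x
  refine ⟨(memLp_two_iff_integrable_sq hm.aestronglyMeasurable).2 hint, ?_⟩
  rw [← integral_add hi hj, ← integral_const_mul]
  exact integral_mono hint ((hi.add hj).const_mul (1 / 2)) hle

theorem popCov_apply [IsProbabilityMeasure P] (hP : BoundedFourthMoments K P) (i j : Fin p) :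
    popCov P i j = ∫ x, x i * x j ∂P - popMean P i * popMean P j := by
  rw [popCov, Matrix.of_apply, covariance_eq_sub ((hP i).1.mono_exponent (by norm_num))
    ((hP j).1.mono_exponent (by norm_num))]
  rfl

end Moments

/-! ### Error of the robust covariance estimate -/

section RobustCovariance

variable {n p : ℕ} {K R : ℝ} {P : Measure (Fin p → ℝ)}

/-- The inverse of a singular matrix is 0 by convention, which is not positive definite when an
index exists. -/
theorem isUnit_det_of_posDef_inv {A : Matrix (Fin p) (Fin p) ℝ} (i : Fin p)
    (h : A⁻¹.PosDef) : IsUnit A.det := by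
  by_contra hA
  rw [Matrix.nonsing_inv_apply_not_isUnit _ hA] at h
  exact lt_irrefl _ (h.diag_pos (i := i))

/-- Deterministic error bound of the robust covariance estimate. -/
theorem abs_robustCov_sub_le {Sig S S₀ : Matrix (Fin p) (Fin p) ℝ} {ε r : ℝ}
    {μ m : Fin p → ℝ} (hproj : IsConeProjection ε S₀ S) (hSig : Sig ∈ psdCone p ε) (hr1 : r ≤ 1)
    (hr0 : 0 ≤ r) (hμ : ∀ i, |μ i| ≤ R) (hm : ∀ i, |m i - μ i| ≤ r)
    (hS₀ : ∀ i j, |S₀ i j + m i * m j - (Sig i j + μ i * μ j)| ≤ r) (i j : Fin p) :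
    |S i j - Sig i j| ≤ 2 * ((2 * R + 2) * r) := by
  have hR : 0 ≤ R := (abs_nonneg _).trans (hμ i)
  have hmR : ∀ i, |m i| ≤ R + 1 := fun i => by
    have := abs_sub_abs_le_abs_sub (m i) (μ i)
    linarith [hm i, hμ i]
  have h0 : maxNorm (Sig - S₀) ≤ (2 * R + 2) * r := by
    refine maxNorm_le (by positivity) fun i j => ?_
    have e : (Sig - S₀) i j = -(S₀ i j + m i * m j - (Sig i j + μ i * μ j))
        + ((m i - μ i) * m j + μ i * (m j - μ j)) := by
      rw [Matrix.sub_apply]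
      ring
    have h1 : |(m i - μ i) * m j| ≤ r * (R + 1) := by
      rw [abs_mul]
      exact mul_le_mul (hm i) (hmR j) (abs_nonneg _) hr0
    have h2 : |μ i * (m j - μ j)| ≤ R * r := by
      rw [abs_mul]
      exact mul_le_mul (hμ i) (hm j) (abs_nonneg _) hR
    rw [e]
    refine (abs_add_le _ _).trans ?_
    rw [abs_neg]
    linarith [abs_add_le ((m i - μ i) * m j) (μ i * (m j - μ j)), hS₀ i j]
  -- `Sig` competes in the projection, so `S` is no farther from `S₀` than `Sig` is.
  have h1 : maxNorm (S - S₀) ≤ maxNorm (Sig - S₀) := hproj.2 hSig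
  linarith [maxNorm_sub_le (h1.trans h0) h0 i j]

/-- The samples for which some Huber estimate of a first or second moment is far off. -/
def badSet (P : Measure (Fin p → ℝ)) {𝓧 : Type*} (X : Fin n → 𝓧 → Fin p → ℝ) (H r : ℝ) : Set 𝓧 :=
  (⋃ i, {ω | ∃ m, ∑ k, huberPsi H (X k ω i - m) = 0 ∧ r ≤ |m - ∫ x, x i ∂P|}) ∪
    ⋃ ij : Fin p × Fin p, {ω | ∃ m, ∑ k, huberPsi H (X k ω ij.1 * X k ω ij.2 - m) = 0 ∧
      r ≤ |m - ∫ x, x ij.1 * x ij.2 ∂P|}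

/-- `S₀ i j + m i * m j` is a Huber root for the products, hence close to the raw second moment
whichever roots were chosen. -/
theorem abs_sub_popCov_le [IsProbabilityMeasure P] {𝓧 : Type*} {X : Fin n → 𝓧 → Fin p → ℝ}
    {H r ε : ℝ} (hP : BoundedFourthMoments K P) (hμ : ∀ i, |popMean P i| ≤ R) (hr0 : 0 ≤ r)
    (hr1 : r ≤ 1) (hcone : popCov P ∈ psdCone p ε) {ω : 𝓧} (hω : ω ∉ badSet P X H r)
    {S : Matrix (Fin p) (Fin p) ℝ} (hS : IsRobustCov H ε (fun k => X k ω) S) (i j : Fin p) :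
    |S i j - popCov P i j| ≤ 2 * ((2 * R + 2) * r) := by
  obtain ⟨m, S₀, hm, hS₀, hproj⟩ := hS
  simp only [badSet, Set.mem_union, Set.mem_iUnion, Set.mem_ofPred_eq, not_or, not_exists,
    not_and, not_le, Prod.forall] at hω
  refine abs_robustCov_sub_le hproj hcone hr1 hr0 hμ (fun i => (hω.1 i (m i) (hm i)).le)
    (fun i j => ?_) i j
  rw [popCov_apply hP, sub_add_cancel]
  exact (hω.2 i j _ (hS₀ i j)).le

/-- Union bound over `p + p² ≤ 2p²` events; the exponent `τ + 2` pays for the factor `p²`. The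
single `V` bounds the second moments of both coordinates and products. -/
theorem measure_badSet_le {κ τ C V : ℝ} {𝓧 : Type*} [MeasurableSpace 𝓧] {Pr : Measure 𝓧}
    [IsProbabilityMeasure Pr] [IsProbabilityMeasure P] {X : Fin n → 𝓧 → Fin p → ℝ}
    (hp : 2 ≤ p) (hn : 0 < n) (hκ : 0 < κ) (hV : V = 1 + 8 * (K + R ^ 4))
    (hC : C = κ * (τ + 2) + 2 * (V + 1) / κ) (hsmall : (C * √(Real.log p / n)) ^ 2 ≤ 1)
    (hX : ∀ k, HasLaw (X k) P Pr) (hind : iIndepFun X Pr) (hP : BoundedFourthMoments K P)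
    (hμ : ∀ i, |popMean P i| ≤ R) :
    Pr (badSet P X (κ * ((n : ℝ) / Real.log p) ^ (1 / 2 : ℝ)) (C * √(Real.log p / n))) ≤
      ENNReal.ofReal (4 * (p : ℝ) ^ (-τ)) := by
  have hp1 : (1 : ℝ) ≤ p := by exact_mod_cast (by lia : 1 ≤ p)
  have h1 := fun i : Fin p => measure_huber_root_far_le_rpow (g := fun x => x i) hp hn hκ hC
    hsmall hX hind (by fun_prop) ((hP i).1.mono_exponent (by norm_num))
    (hV ▸ integral_sq_le hP hμ i)
  have h2 := fun ij : Fin p × Fin p => measure_huber_root_far_le_rpow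
    (g := fun x => x ij.1 * x ij.2) hp hn hκ hC hsmall hX hind (by fun_prop)
    (memLp_mul hP ij.1 ij.2).1
    (by linarith [(memLp_mul hP ij.1 ij.2).2, integral_pow_four_le hP hμ ij.1,
      integral_pow_four_le hP hμ ij.2])
  refine (measure_union_le _ _).trans ((add_le_add
    ((measure_iUnion_fintype_le _ _).trans (Finset.sum_le_sum fun i _ => h1 i))
    ((measure_iUnion_fintype_le _ _).trans (Finset.sum_le_sum fun ij _ => h2 ij))).trans ?_)
  have hnn : 0 ≤ 2 * (p : ℝ) ^ (-(τ + 2)) := by positivity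
  rw [← ENNReal.ofReal_sum_of_nonneg fun _ _ => hnn, ← ENNReal.ofReal_sum_of_nonneg fun _ _ => hnn,
    ← ENNReal.ofReal_add (Finset.sum_nonneg fun _ _ => hnn) (Finset.sum_nonneg fun _ _ => hnn)]
  refine ENNReal.ofReal_le_ofReal ?_
  have e : (p : ℝ) ^ (-τ) = (p : ℝ) ^ 2 * (p : ℝ) ^ (-(τ + 2)) := by
    rw [← Real.rpow_natCast, ← Real.rpow_add (by positivity)]
    congr 1
    push_cast
    ring
  simp only [Finset.sum_const, Finset.card_univ, Fintype.card_prod, Fintype.card_fin,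
    nsmul_eq_mul, Nat.cast_mul]
  rw [e]
  have : (p : ℝ) * (p : ℝ) ^ (-(τ + 2)) ≤ (p : ℝ) ^ 2 * (p : ℝ) ^ (-(τ + 2)) := by
    gcongr
    nlinarith
  linarith

end RobustCovariance

end SCIO

/-! ### The main theorem -/

theorem corollary2 (q K R κ τ : ℝ) (hq0 : 0 ≤ q) (hq1 : q < 1) (hK : 0 < K) (hR : 0 < R)
    (hκ : 0 < κ) (hτ : 0 < τ) :
    ∃ C₀min > 0, ∀ C₀ ≥ C₀min, ∃ C₁ > 0, ∃ C₂ > 0, ∃ C₃ > 0,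
      ∀ (p : ℕ → ℕ) (s M : ℕ → ℝ), (∀ n, 2 ≤ p n) →
        (fun n => s n * M n ^ (1 - 2 * q)) =o[atTop]
          (fun n => ((n : ℝ) / Real.log (p n)) ^ (1 / 2 - q / 2)) →
        (fun n => Real.log (p n)) =o[atTop] (fun n => (n : ℝ)) →
        ∀ᶠ n : ℕ in atTop,
          ∀ (𝓧 : Type*) [MeasurableSpace 𝓧] (Pr : Measure 𝓧) [IsProbabilityMeasure Pr]
            (P : Measure (Fin (p n) → ℝ)) (X : Fin n → 𝓧 → Fin (p n) → ℝ) (ε : ℝ),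
            (∀ k, HasLaw (X k) P Pr) → iIndepFun X Pr →
            SparseClass q (s n) (M n) (popCov P)⁻¹ →
            BoundedFourthMoments K P → (∀ i, |popMean P i| ≤ R) →
            0 < ε → popCov P ∈ psdCone (p n) ε →
            (∀ ω, ∃ A, IsRobustScio (κ * ((n : ℝ) / Real.log (p n)) ^ (1 / 2 : ℝ)) ε
                (C₀ * M n * Real.sqrt (Real.log (p n) / n)) (fun k => X k ω) A) ∧
            Pr {ω | ∃ A, IsRobustScio (κ * ((n : ℝ) / Real.log (p n)) ^ (1 / 2 : ℝ)) ε
                (C₀ * M n * Real.sqrt (Real.log (p n) / n)) (fun k => X k ω) A ∧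
                ¬ (maxNorm (A - (popCov P)⁻¹) ≤
                      C₁ * M n ^ 2 * Real.sqrt (Real.log (p n) / n) ∧
                    l1Norm (A - (popCov P)⁻¹) ≤
                      C₂ * s n * M n ^ (2 - 2 * q) *
                        (Real.log (p n) / n) ^ (1 / 2 * (1 - q)))} ≤
              ENNReal.ofReal (C₃ * (p n : ℝ) ^ (-τ)) := by
  obtain ⟨V, hV⟩ : ∃ V, V = 1 + 8 * (K + R ^ 4) := ⟨_, rfl⟩
  obtain ⟨C, hC⟩ : ∃ C, C = κ * (τ + 2) + 2 * (V + 1) / κ := ⟨_, rfl⟩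
  have hVpos : 0 < V := by rw [hV]; positivity
  have hCpos : 0 < C := by rw [hC]; positivity
  -- With `δ = 2 (2R + 2) C a`, this threshold is what `2δM ≤ λ` requires.
  refine ⟨4 * ((2 * R + 2) * C), by positivity, fun C₀ hC₀ => ?_⟩
  have hC₀pos : 0 < C₀ := lt_of_lt_of_le (by positivity) hC₀
  -- From `3Mλ = 3 C₀ M² a`, and its power `1 - q` times 8.
  refine ⟨3 * C₀, by positivity, 8 * (3 * C₀) ^ (1 - q), by positivity, 4, by norm_num, ?_⟩
  intro p s M hp _ hlogp
  have hlim : Tendsto (fun n : ℕ => C ^ 2 * (Real.log (p n) / n)) atTop (𝓝 0) := by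
    simpa using hlogp.tendsto_div_nhds_zero.const_mul (C ^ 2)
  filter_upwards [hlim.eventually_le_const zero_lt_one, eventually_gt_atTop 0] with n hsmall hn
  intro 𝓧 _ Pr _ P X ε hX hind hΩ hP hμ hε hcone
  have : IsProbabilityMeasure P := (hX ⟨0, hn⟩).isProbabilityMeasure_iff.1 inferInstance
  have hn' : (0 : ℝ) < n := by exact_mod_cast hn
  have hlog : 0 < Real.log (p n) := Real.log_pos (by exact_mod_cast hp n)
  have i₀ : Fin (p n) := ⟨0, by linarith [hp n]⟩
  obtain ⟨hs, hM⟩ := hΩ.pos i₀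
  have hquot : 0 < Real.log (p n) / n := by positivity
  set a := √(Real.log (p n) / n) with ha
  have hapos : 0 < a := Real.sqrt_pos.2 hquot
  have hr2 : (C * a) ^ 2 ≤ 1 := by rwa [mul_pow, ha, Real.sq_sqrt hquot.le]
  have hr1 : C * a ≤ 1 := by nlinarith [mul_pos hCpos hapos]
  have hlam : 0 < C₀ * M n * a := by positivity
  refine ⟨fun ω => exists_isRobustScio (by positivity) hε hlam.le _, ?_⟩
  -- The failure event need not be measurable; it suffices that it lies in the bad set.
  refine (measure_mono fun ω hω => ?_).trans
    (measure_badSet_le (hp n) hn hκ hV hC hr2 hX hind hP hμ)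
  by_contra hgood
  obtain ⟨A, ⟨S, hS, hA⟩, hbad⟩ := hω
  have hpsd : S.PosSemidef := by
    obtain ⟨_, _, _, _, hproj⟩ := hS
    exact posSemidef_of_mem_psdCone hε.le hproj.1
  obtain ⟨h1, h2⟩ := scio_error hq0 hq1 (isUnit_det_of_posDef_inv i₀ hΩ.posDef) hΩ hpsd hM hlam hs
    (abs_sub_popCov_le hP hμ (by positivity) hr1 hcone hgood hS)
    (by
      have := mul_le_mul_of_nonneg_right hC₀ (by positivity : 0 ≤ M n * a)
      linarith) hA
  refine hbad ⟨h1.trans_eq (by ring), h2.trans_eq ?_⟩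
  have e1 : 3 * M n * (C₀ * M n * a) = 3 * C₀ * M n ^ 2 * a := by ring
  have e2 : (M n ^ 2) ^ (1 - q) = M n ^ (2 - 2 * q) := by
    rw [← Real.rpow_natCast, ← Real.rpow_mul hM.le]
    congr 1
    push_cast
    ring
  have e3 : a ^ (1 - q) = (Real.log (p n) / n) ^ (1 / 2 * (1 - q)) := by
    rw [ha, Real.sqrt_eq_rpow, ← Real.rpow_mul hquot.le]
  rw [e1, Real.mul_rpow (by positivity) hapos.le, Real.mul_rpow (by positivity) (by positivity),
    e2, e3]
  ring
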